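/- Let $G=(V,E)$ be a finite directed graph (loops allowed) with edge weights $w:E\to\mathbb{R}_{\ge 0}$, $n=|V|$, $m=|E|$, and assume that $G$ is Eulerian: at every vertex the total weight of incoming edges equals the total weight of outgoing edges. A hierarchical decomposition $\mathcal{T}$ of $G$ is obtained as follows. For every $e\in E$ choose a directed cycle $C_e$ of $G$ that contains $e$ and all of whose edges have weight at least $w(e)/m$. Sort these $m$ cycles by minimum edge weight in decreasing order (ties broken arbitrarily) as $C_1,\dots,C_m$. The nodes of $\mathcal{T}$ are the vertex sets of the connected components of the graphs $(V, C_1\cup\dots\cup C_i)$, $i=1,\dots,m$, with duplicates identified; ancestors of a node are the nodes containing it. An edge $e\in E$ jumps between children of $\mathcal{S}\in\mathcal{T}$ if $\mathcal{S}$ is the lowest (smallest) node that contains both endpoints of $e$. Let $(X_k)_{k\ge 0}$ be the random walk on $G$ started at a vertex $v_0$: from $u$ it moves along an outgoing edge $(u,v)$ with probability proportional to $w(u,v)$. (1) For every such $\mathcal{T}$, every $v_0$ from which the walk is defined and every node $\mathcal{S}\in\mathcal{T}$, the expected number of traversals of edges that jump between children of $\mathcal{S}$ before all vertices of $\mathcal{S}$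 have been visited is at most $n^2m^2$. (2) For every $c\in\mathbb{N}$ there is a polynomial $p$ in two variables with nonnegative integer coefficients such that for all $G$, $\mathcal{T}$, $v_0$ as above and every $L\ge p(n,m)$ the following holds. Call the transcript the set of all steps of the walk that are, for some node $\mathcal{S}\in\mathcal{T}$, among the first $L$ traversals of edges that jump between children of $\mathcal{S}$. The transcript always has at most $2nL$ steps, and with probability at least $1-(n+m)^{-c}$ every node $\mathcal{S}\in\mathcal{T}$ is covered by the time $L$ edges jumping between children of $\mathcal{S}$ have been traversed, and every first-visit step (a step of the walk that reaches a vertex for the first time) belongs to the transcript. -/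

import Mathlib

open MeasureTheory
open scoped NNReal ENNReal

/-- A finite directed graph on `V` (loops allowed) with nonnegative edge weights.  For convenience
the weight is a function on all pairs, equal to `0` on pairs that are not edges. -/
structure WDigraph (V : Type*) where
  edges : Finset (V × V)
  weight : V × V → ℝ≥0
  weight_eq_zero : ∀ e, e ∉ edges → weight e = 0

namespace WDigraph

/-- Total weight of the edges leaving `u`. -/
noncomputable def outDeg {V : Type*} [Fintype V] (G : WDigraph V) (u : V) : ℝ≥0 :=
  ∑ v, G.weight (u, v)

/-- Total weight of the edges entering `v`. -/
noncomputable def inDeg {V : Type*} [Fintype V] (G : WDigraph V) (v : V) : ℝ≥0 :=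
  ∑ u, G.weight (u, v)

/-- Weighted in-degree equals weighted out-degree at every vertex. -/
def Eulerian {V : Type*} [Fintype V] (G : WDigraph V) : Prop :=
  ∀ v, G.inDeg v = G.outDeg v

/-- `C` is the edge set of a directed cycle `p 0 → p 1 → ⋯ → p k → p 0` of `G` through distinct
vertices (addition in `Fin (k + 1)` is modulo `k + 1`; a loop is a cycle with `k = 0`). -/
def IsCycle {V : Type*} (G : WDigraph V) (C : Set (V × V)) : Prop :=
  ∃ (k : ℕ) (p : Fin (k + 1) → V), Function.Injective p ∧
    C = Set.range (fun i => (p i, p (i + 1))) ∧ ∀ e ∈ C, e ∈ G.edges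

/-- The minimum weight of an edge in `C` (for `C` finite and nonempty). -/
noncomputable def minWeight {V : Type*} (G : WDigraph V) (C : Set (V × V)) : ℝ≥0 :=
  sInf (G.weight '' C)

/-- The choices made in one run of the decomposition algorithm on `G`, where `m` is the number of
edges: for every edge `e` a cycle through `e` all of whose edges have weight at least `w(e) / m`,
and an ordering of these `m` cycles by decreasing minimum edge weight (ties broken in any way). -/
structure DecompositionRun {V : Type*} (G : WDigraph V) where
  cycle : G.edges → Set (V × V)
  isCycle : ∀ e, G.IsCycle (cycle e)
  mem_cycle : ∀ e, (e : V × V) ∈ cycle e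
  le_weight : ∀ e, ∀ e' ∈ cycle e, G.weight e / (G.edges.card : ℝ≥0) ≤ G.weight e'
  order : Fin G.edges.card ≃ G.edges
  sorted : Antitone fun i => G.minWeight (cycle (order i))

namespace DecompositionRun

/-- The graph on `V` formed by the cycles number `0, …, i`, with directions forgotten. -/
def stage {V : Type*} {G : WDigraph V} (R : G.DecompositionRun) (i : Fin G.edges.card) :
    SimpleGraph V :=
  SimpleGraph.fromRel fun u v => ∃ j ≤ i, (u, v) ∈ R.cycle (R.order j)

/-- The nodes of the hierarchical decomposition: the vertex sets of the connected components of
all stages (equal sets are one node; ancestors of a node are the nodes containing it). -/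
def nodes {V : Type*} {G : WDigraph V} (R : G.DecompositionRun) : Set (Set V) :=
  {S | ∃ (i : Fin G.edges.card) (c : (R.stage i).ConnectedComponent), S = c.supp}

/-- The edge `e` jumps between children of the node `S`: `S` is the lowest node that contains both
endpoints of `e`. -/
def Jumps {V : Type*} {G : WDigraph V} (R : G.DecompositionRun) (S : Set V) (e : V × V) : Prop :=
  e ∈ G.edges ∧ S ∈ R.nodes ∧ e.1 ∈ S ∧ e.2 ∈ S ∧
    ∀ S' ∈ R.nodes, e.1 ∈ S' → e.2 ∈ S' → S ⊆ S'

end DecompositionRun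

/-- The process `X` is a random walk on `G` started at `v₀`: given the history `x 0, …, x k`, the
next vertex is `x (k + 1)` with probability `w(x k, x (k + 1)) / deg(x k)`.  (Since `0 / 0 = 0`,
such a process never reaches a vertex without outgoing weight, where the walk is undefined.) -/
structure IsRandomWalk {V Ω : Type*} [Fintype V] [MeasurableSpace Ω] (G : WDigraph V)
    (P : Measure Ω) (X : ℕ → Ω → V) (v₀ : V) : Prop where
  measurableSet_eq : ∀ k v, MeasurableSet {ω | X k ω = v}
  start : ∀ᵐ ω ∂P, X 0 ω = v₀
  step : ∀ (k : ℕ) (x : ℕ → V),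
    P {ω | ∀ i ≤ k + 1, X i ω = x i} =
      P {ω | ∀ i ≤ k, X i ω = x i} * ((G.weight (x k, x (k + 1)) / G.outDeg (x k) : ℝ≥0) : ℝ≥0∞)

end WDigraph

/-- All vertices of `S` have been visited by the path `x` at times `0, …, k`. -/
def CoveredBy {V : Type*} (S : Set V) (x : ℕ → V) (k : ℕ) : Prop :=
  ∀ v ∈ S, ∃ i ≤ k, x i = v

/-- Step `k` of the path `x` (from time `k` to time `k + 1`) reaches a vertex for the first time;
the edge `(x k, x (k + 1))` is then the first-visit edge of `x (k + 1)`. -/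
def IsFirstVisitStep {V : Type*} (x : ℕ → V) (k : ℕ) : Prop :=
  ∀ i ≤ k, x i ≠ x (k + 1)

namespace WDigraph.DecompositionRun

/-- The steps at which the path `x` traverses an edge between children of `S`. -/
def jumpSteps {V : Type*} {G : WDigraph V} (R : G.DecompositionRun) (S : Set V) (x : ℕ → V) :
    Set ℕ :=
  {k | R.Jumps S (x k, x (k + 1))}

/-- The number of edges between children of `S` that the path `x` traverses before all vertices of
`S` have been visited. -/
noncomputable def jumpsBeforeCover {V : Type*} {G : WDigraph V} (R : G.DecompositionRun)
    (S : Set V) (x : ℕ → V) : ℕ∞ :=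
  {k ∈ R.jumpSteps S x | ¬ CoveredBy S x k}.encard

/-- The steps of the path `x` that are, for some node `S`, one of the first `L` traversals of an
edge between children of `S`. -/
def transcript {V : Type*} {G : WDigraph V} (R : G.DecompositionRun) (L : ℕ) (x : ℕ → V) : Set ℕ :=
  {k | ∃ S ∈ R.nodes, k ∈ R.jumpSteps S x ∧ {i ∈ R.jumpSteps S x | i ≤ k}.encard ≤ L}

end WDigraph.DecompositionRun

/-! In an Eulerian graph `outDeg` is an invariant measure of the walk. Hence, for any step cost `j`,
returning from the head of an edge `(u, v)` to `u` has expected cost at most `(∑ w * j) / w(u, v)`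
(`Eulerian.weight_mul_hitCost_le`).

Fix a node `S`, take the earliest stage at which it is a component, and let `w₀` be the minimum
weight of the cycle added there. All cycle edges so far weigh at least `w₀`, while edges jumping
between children of `S` lie only on cycles sorted no earlier, so they weigh at most `m * w₀`
(`exists_stage`). With `j` counting jumps, `∑ w * j ≤ m * (m * w₀)`, so undoing one cycle edge costs
at most `m²`. Any two vertices of `S` are linked by such edges, giving hitting cost `n * m²` and
cover cost `n² * m²`.

Costs are truncated at a horizon `T`, so they are finite and can be cancelled;
`sum_measure_jumpEvent_le` transfers the bound to the process. Part (2) is Markov's inequality and a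
union bound over at most `2n` nodes, which form a laminar family. -/

namespace WDigraph

/-! ### Hitting and cover costs of the Markov chain -/

section Walk

variable {V : Type*} [Fintype V]

/-- Transition probability of the random walk from `x` to `y`. -/
noncomputable def stepProb (G : WDigraph V) (x y : V) : ℝ≥0 :=
  G.weight (x, y) / G.outDeg x

lemma outDeg_mul_stepProb (G : WDigraph V) (x y : V) :
    G.outDeg x * G.stepProb x y = G.weight (x, y) := by
  by_cases h : G.outDeg x = 0
  · have : G.weight (x, y) = 0 := (Finset.sum_eq_zero_iff.mp h) y (Finset.mem_univ _)
    rw [h, this, zero_mul]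
  · exact mul_div_cancel₀ _ h

lemma sum_stepProb_le_one (G : WDigraph V) (x : V) : ∑ y, G.stepProb x y ≤ 1 := by
  simp only [stepProb]
  rw [← Finset.sum_div]
  exact div_self_le_one _

lemma sum_stepProb_mul_add_le (G : WDigraph V) (x : V) (f : V → ℝ≥0) (b : ℝ≥0) :
    ∑ y, G.stepProb x y * (f y + b) ≤ ∑ y, G.stepProb x y * f y + b := by
  simp only [mul_add, Finset.sum_add_distrib]
  rw [← Finset.sum_mul]
  gcongr
  exact mul_le_of_le_one_left' (G.sum_stepProb_le_one x)

open Classical in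
/-- The expected total cost `j` of the steps among the first `T` that a walk from `x` makes before
it hits `z`. -/
noncomputable def hitCost (G : WDigraph V) (j : V → V → ℝ≥0) (z : V) : ℕ → V → ℝ≥0
  | 0, _ => 0
  | T + 1, x => if x = z then 0 else ∑ y, G.stepProb x y * (j x y + hitCost G j z T y)

lemma hitCost_self (G : WDigraph V) (j : V → V → ℝ≥0) (z : V) (T : ℕ) :
    G.hitCost j z T z = 0 := by
  cases T <;> simp [hitCost]

lemma hitCost_succ (G : WDigraph V) (j : V → V → ℝ≥0) {z x : V} (T : ℕ) (h : x ≠ z) :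
    G.hitCost j z (T + 1) x = ∑ y, G.stepProb x y * (j x y + G.hitCost j z T y) := by
  simp [hitCost, h]

lemma hitCost_le_succ (G : WDigraph V) (j : V → V → ℝ≥0) (z : V) (T : ℕ) (x : V) :
    G.hitCost j z T x ≤ G.hitCost j z (T + 1) x := by
  induction T generalizing x with
  | zero => simp [hitCost]
  | succ T ih =>
    by_cases h : x = z
    · subst h; simp [hitCost_self]
    · rw [hitCost_succ _ _ _ h, hitCost_succ _ _ _ h]
      gcongr
      exact ih _

/-- In an Eulerian graph the cost of returning from the head of an edge to its tail is at most the
cost of a step in the stationary distribution, relative to the weight of the edge. -/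
lemma Eulerian.weight_mul_hitCost_le {G : WDigraph V} (hG : G.Eulerian) (j : V → V → ℝ≥0)
    (u v : V) (T : ℕ) :
    G.weight (u, v) * G.hitCost j u T v ≤ ∑ x, ∑ y, G.weight (x, y) * j x y := by
  classical
  set h := G.hitCost j u
  -- Invariance of `outDeg` turns the one-step recursion, an equality away from `u`, into this sum;
  -- the extra term arises at `u`, where the hitting cost is 0.
  have key : ∑ x, G.outDeg x * h (T + 1) x + ∑ y, G.weight (u, y) * h T y ≤
      ∑ x, ∑ y, G.weight (x, y) * j x y + ∑ x, G.outDeg x * h T x := by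
    have h1 : ∑ x, G.outDeg x * h T x = ∑ x, ∑ y, G.weight (x, y) * h T y := by
      rw [Finset.sum_comm]
      refine Finset.sum_congr rfl fun y _ => ?_
      rw [← hG y, inDeg, Finset.sum_mul]
    have h2 : ∀ x, G.outDeg x * h (T + 1) x + (if x = u then ∑ y, G.weight (u, y) * h T y else 0) ≤
        ∑ y, G.weight (x, y) * j x y + ∑ y, G.weight (x, y) * h T y := by
      intro x
      by_cases hx : x = u
      · subst hx
        simp [h, hitCost_self]
      · simp only [h, hitCost_succ _ _ _ hx, hx, if_false, add_zero, Finset.mul_sum, ← mul_assoc,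
          outDeg_mul_stepProb, mul_add, Finset.sum_add_distrib, le_refl]
    rw [h1]
    have h4 := Finset.sum_le_sum (s := Finset.univ) fun x _ => h2 x
    rw [Finset.sum_add_distrib, Finset.sum_add_distrib, Finset.sum_ite_eq' Finset.univ u] at h4
    simpa using h4
  have mono : ∑ x, G.outDeg x * h T x ≤ ∑ x, G.outDeg x * h (T + 1) x := by
    gcongr with x
    exact G.hitCost_le_succ j u T x
  have h3 : ∑ y, G.weight (u, y) * h T y ≤ ∑ x, ∑ y, G.weight (x, y) * j x y := by
    have := key.trans (add_le_add_right mono _)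
    rw [add_comm] at this
    exact le_of_add_le_add_right this
  exact (Finset.single_le_sum (f := fun y => G.weight (u, y) * h T y) (fun _ _ => zero_le)
    (Finset.mem_univ v)).trans h3

/-- Triangle inequality: a walk that goes to `y` first and then to `z`. The bound `b` is uniform in
the horizon because the time left on reaching `y` varies. -/
lemma hitCost_le_hitCost_add (G : WDigraph V) (j : V → V → ℝ≥0) {y z : V} {b : ℝ≥0}
    (hb : ∀ T, G.hitCost j z T y ≤ b) (T : ℕ) (x : V) :
    G.hitCost j z T x ≤ G.hitCost j y T x + b := by
  induction T generalizing x with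
  | zero => simp [hitCost]
  | succ T ih =>
    by_cases hz : x = z
    · subst hz; simp [hitCost_self]
    by_cases hy : x = y
    · subst hy; exact (hb _).trans (by simp)
    rw [hitCost_succ _ _ _ hz, hitCost_succ _ _ _ hy]
    refine le_trans ?_ (G.sum_stepProb_mul_add_le x _ b)
    simp only [add_assoc]
    gcongr with w
    exact ih w

/-- If costs arise only inside `S`, a bound on hitting costs from `S` holds from everywhere. -/
lemma hitCost_le_of_forall_mem (G : WDigraph V) (j : V → V → ℝ≥0) {S : Set V} {z : V} {D : ℝ≥0}
    (hj : ∀ x y, x ∉ S → j x y = 0) (hD : ∀ T, ∀ x ∈ S, G.hitCost j z T x ≤ D) (T : ℕ) (x : V) :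
    G.hitCost j z T x ≤ D := by
  induction T generalizing x with
  | zero => simp [hitCost]
  | succ T ih =>
    by_cases hS : x ∈ S
    · exact hD _ x hS
    by_cases hz : x = z
    · subst hz; simp [hitCost_self]
    rw [hitCost_succ _ _ _ hz]
    calc ∑ y, G.stepProb x y * (j x y + G.hitCost j z T y)
        ≤ ∑ y, G.stepProb x y * (0 + D) := by
          gcongr with y
          · exact (hj x y hS).le
          · exact ih y
      _ ≤ _ := (G.sum_stepProb_mul_add_le x (fun _ => 0) D).trans (by simp)

open Classical in
/-- The expected total cost `j` of the steps among the first `T` that a walk from `x` makes before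
it has covered `S`, if the vertices of `A` have been visited already. -/
noncomputable def coverCost (G : WDigraph V) (j : V → V → ℝ≥0) (S : Set V) :
    ℕ → V → Set V → ℝ≥0
  | 0, _, _ => 0
  | T + 1, x, A =>
    if S ⊆ A then 0 else ∑ y, G.stepProb x y * (j x y + coverCost G j S T y (insert y A))

lemma coverCost_of_subset (G : WDigraph V) (j : V → V → ℝ≥0) {S A : Set V} (h : S ⊆ A) (T : ℕ)
    (x : V) : G.coverCost j S T x A = 0 := by
  cases T <;> simp [coverCost, h]

lemma coverCost_succ (G : WDigraph V) (j : V → V → ℝ≥0) {S A : Set V} (h : ¬ S ⊆ A) (T : ℕ)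
    (x : V) : G.coverCost j S (T + 1) x A =
      ∑ y, G.stepProb x y * (j x y + G.coverCost j S T y (insert y A)) := by
  simp [coverCost, h]

lemma ncard_diff_insert_add_one {S A : Set V} {z : V} (hz : z ∈ S) (hzA : z ∉ A) :
    (S \ insert z A).ncard + 1 = (S \ A).ncard := by
  have : S \ insert z A = (S \ A) \ {z} := by
    ext; simp only [Set.mem_sdiff, Set.mem_insert_iff, Set.mem_singleton_iff]; tauto
  rw [this]
  exact Set.ncard_sdiff_singleton_add_one ⟨hz, hzA⟩

/-- Keep an unvisited target `z` until it is hit, then choose another. Each later target costs at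
most `D`, and vertices met on the way only shorten the list. -/
lemma coverCost_le_hitCost_add (G : WDigraph V) (j : V → V → ℝ≥0) {S : Set V} {D : ℝ≥0}
    (hD : ∀ z ∈ S, ∀ T x, G.hitCost j z T x ≤ D) (T : ℕ) (x : V) (A : Set V) (hx : x ∈ A)
    (z : V) (hz : z ∈ S) (hzA : z ∉ A) :
    G.coverCost j S T x A ≤ G.hitCost j z T x + (S \ insert z A).ncard * D := by
  induction T generalizing x A z with
  | zero => simp [coverCost]
  | succ T ih =>
    have hxz : x ≠ z := fun h => hzA (h ▸ hx)
    rw [coverCost_succ _ _ (fun h => hzA (h hz)), hitCost_succ _ _ _ hxz]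
    refine le_trans ?_ (G.sum_stepProb_mul_add_le x _ _)
    simp only [add_assoc]
    gcongr with y
    by_cases hy : y = z
    · subst hy
      rw [hitCost_self, zero_add]
      by_cases hS : S ⊆ insert y A
      · rw [coverCost_of_subset _ _ hS]; exact zero_le
      obtain ⟨z', hz', hz'A⟩ := Set.not_subset.mp hS
      refine (ih y _ (Set.mem_insert _ _) z' hz' hz'A).trans ?_
      rw [← ncard_diff_insert_add_one hz' hz'A]
      push_cast
      rw [add_mul, one_mul, add_comm]
      gcongr
      exact hD z' hz' T y
    · refine (ih y _ (Set.mem_insert _ _) z hz ?_).trans ?_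
      · rintro (h | h)
        · exact hy h.symm
        · exact hzA h
      · gcongr
        · exact Set.toFinite _
        · exact Set.subset_insert _ _

lemma coverCost_le (G : WDigraph V) (j : V → V → ℝ≥0) {S : Set V} {D : ℝ≥0}
    (hD : ∀ z ∈ S, ∀ T x, G.hitCost j z T x ≤ D) (T : ℕ) (x : V) (A : Set V) (hx : x ∈ A) :
    G.coverCost j S T x A ≤ (S \ A).ncard * D := by
  by_cases hS : S ⊆ A
  · rw [coverCost_of_subset _ _ hS]; exact zero_le
  obtain ⟨z, hz, hzA⟩ := Set.not_subset.mp hS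
  refine (G.coverCost_le_hitCost_add j hD T x A hx z hz hzA).trans ?_
  rw [← ncard_diff_insert_add_one hz hzA]
  push_cast
  rw [add_mul, one_mul, add_comm]
  gcongr
  exact hD z hz T x

/-- If the cost of returning along each edge of the relation `r` is at most `b`, then the cost of
hitting `z` is at most `|V| * b` from every vertex in the `r`-closure of `z`. -/
lemma hitCost_le_of_closed (G : WDigraph V) (j : V → V → ℝ≥0) {r : V → V → Prop} {b : ℝ≥0}
    (hr : ∀ u v, r u v → ∀ T, G.hitCost j u T v ≤ b) {S : Set V} {z : V}
    (hS : ∀ R : Set V, z ∈ R → (∀ u v, r u v → u ∈ R → v ∈ R) → S ⊆ R) (T : ℕ) {x : V}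
    (hx : x ∈ S) : G.hitCost j z T x ≤ Fintype.card V * b := by
  -- From `v` one can go back to `u` and then to `z`, so an edge `u → v` raises the level by at most
  -- one. Either `B k` stops growing, is closed and contains `S`, or it gains a vertex at every
  -- level.
  let B : ℕ → Set V := fun k => {x | ∀ T, G.hitCost j z T x ≤ k * b}
  have hz : ∀ k, z ∈ B k := fun k T => by rw [hitCost_self]; exact zero_le
  have hmono : ∀ k l, k ≤ l → B k ⊆ B l := fun k l hkl x hx T => (hx T).trans (by gcongr)
  have hstep : ∀ k u v, r u v → u ∈ B k → v ∈ B (k + 1) := fun k u v huv hu T => by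
    refine (G.hitCost_le_hitCost_add j hu T v).trans ?_
    push_cast
    rw [add_mul, one_mul, add_comm]
    gcongr
    exact hr u v huv T
  have key : ∀ k, S ⊆ B k ∨ k + 1 ≤ (B k).ncard := by
    intro k
    induction k with
    | zero => exact Or.inr (Nat.one_le_iff_ne_zero.mpr
        (Set.ncard_ne_zero_of_mem (hz 0)))
    | succ k ih =>
      rcases ih with ih | ih
      · exact Or.inl (ih.trans (hmono _ _ k.le_succ))
      by_cases hc : B (k + 1) ⊆ B k
      · left
        exact (hS _ (hz k) fun u v huv hu => hc (hstep k u v huv hu)).trans (hmono _ _ k.le_succ)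
      · right
        have : (B k).ncard < (B (k + 1)).ncard :=
          Set.ncard_lt_ncard ⟨hmono _ _ k.le_succ, hc⟩ (Set.toFinite _)
        omega
  rcases key (Fintype.card V) with h | h
  · exact h hx T
  · have : (B (Fintype.card V)).ncard ≤ Fintype.card V := by
      rw [← Nat.card_eq_fintype_card]; exact Set.ncard_le_card _
    omega

end Walk

end WDigraph

/-! ### Cyclic induction and laminar families -/

open Fin.CommRing in
lemma Fin.forall_of_forall_add_one {n : ℕ} {Q : Fin (n + 1) → Prop}
    (h : ∀ i, Q i → Q (i + 1)) {i : Fin (n + 1)} (hi : Q i) (k : Fin (n + 1)) : Q k := by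
  have key : ∀ m : ℕ, Q (i + (m : Fin (n + 1))) := by
    intro m
    induction m with
    | zero => simpa using hi
    | succ m ih => simpa [add_assoc] using h _ ih
  simpa using key (k - i).val

/-- A laminar family of nonempty subsets of a finite type has at most twice as many members as
the type has elements. -/
lemma Set.ncard_le_of_laminar {V : Type*} [Fintype V] {F : Set (Set V)}
    (hne : ∀ A ∈ F, A.Nonempty)
    (hF : ∀ A ∈ F, ∀ B ∈ F, (A ∩ B).Nonempty → A ⊆ B ∨ B ⊆ A) :
    F.ncard ≤ 2 * Fintype.card V := by
  -- The bound `2|U| - 1` is what the induction preserves: for a maximal proper member `T`, every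
  -- member other than `U` lies in `T` or in `U \ T`, and `(2|T| - 1) + (2|U \ T| - 1) + 1 = 2|U| -
  -- 1`.
  have key : ∀ (n : ℕ) (U : Set V), U.ncard ≤ n → U.Nonempty →
      {A ∈ F | A ⊆ U}.ncard + 1 ≤ 2 * U.ncard := by
    intro n
    induction n with
    | zero =>
      intro U hU hne
      have := Set.ncard_ne_zero_of_mem hne.some_mem
      omega
    | succ n ih =>
      intro U hU hUne
      have hU1 := Set.ncard_ne_zero_of_mem hUne.some_mem
      by_cases hT : ∃ T ∈ F, T ⊂ U
      · obtain ⟨T, ⟨hTF, hTU⟩, hmax⟩ :=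
          (Set.toFinite {T | T ∈ F ∧ T ⊂ U}).exists_maximal hT
        have hcard := Set.ncard_sdiff_add_ncard_of_subset hTU.subset
        have hd : (U \ T).Nonempty := Set.nonempty_of_ssubset hTU
        have h1 := Set.ncard_ne_zero_of_mem hd.some_mem
        have h2 := Set.ncard_ne_zero_of_mem (hne T hTF).some_mem
        have i1 := ih T (by omega) (hne T hTF)
        have i2 := ih (U \ T) (by omega) hd
        have hsub : {A ∈ F | A ⊆ U} ⊆ {U} ∪ ({A ∈ F | A ⊆ T} ∪ {A ∈ F | A ⊆ U \ T}) := by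
          rintro A ⟨hA, hAU⟩
          by_cases hEq : A = U
          · exact Or.inl hEq
          right
          by_cases hi : (A ∩ T).Nonempty
          · left
            refine ⟨hA, ?_⟩
            rcases hF A hA T hTF hi with h | h
            · exact h
            · exact hmax ⟨hA, hAU.ssubset_of_ne hEq⟩ h
          · right
            exact ⟨hA, fun x hx => ⟨hAU hx, fun hxT => hi ⟨x, hx, hxT⟩⟩⟩
        have c1 := Set.ncard_le_ncard hsub (Set.toFinite _)
        have c2 := Set.ncard_union_le {U} ({A ∈ F | A ⊆ T} ∪ {A ∈ F | A ⊆ U \ T})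
        have c3 := Set.ncard_union_le {A ∈ F | A ⊆ T} {A ∈ F | A ⊆ U \ T}
        rw [Set.ncard_singleton] at c2
        omega
      · have hsub : {A ∈ F | A ⊆ U} ⊆ {U} := by
          rintro A ⟨hA, hAU⟩
          by_contra hEq
          exact hT ⟨A, hA, hAU.ssubset_of_ne hEq⟩
        have := Set.ncard_le_ncard hsub (Set.toFinite _)
        rw [Set.ncard_singleton] at this
        omega
  rcases isEmpty_or_nonempty V with hV | hV
  · have : F = ∅ := Set.eq_empty_of_forall_notMem fun A hA => hV.elim (hne A hA).some
    simp [this]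
  · have := key _ Set.univ le_rfl Set.univ_nonempty
    simp only [Set.subset_univ, and_true, Set.ofPred_mem_eq, Set.ncard_univ,
      Nat.card_eq_fintype_card] at this
    omega

/-! ### Structure of the hierarchical decomposition -/

namespace WDigraph

lemma minWeight_le {V : Type*} (G : WDigraph V) {C : Set (V × V)} {e : V × V} (he : e ∈ C) :
    G.minWeight C ≤ G.weight e :=
  csInf_le (OrderBot.bddBelow _) ⟨e, he, rfl⟩

/-- Following the cycle from `a` all the way round arrives at `b`, so forward closure gives backward
closure. -/
lemma IsCycle.mem_of_mem {V : Type*} {G : WDigraph V} {C : Set (V × V)} (hC : G.IsCycle C)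
    {B : Set V} (hB : ∀ u v, (u, v) ∈ C → u ∈ B → v ∈ B) {a b : V} (hab : (b, a) ∈ C)
    (ha : a ∈ B) : b ∈ B := by
  obtain ⟨k, p, -, rfl, -⟩ := hC
  obtain ⟨i, hi⟩ := hab
  obtain ⟨rfl, rfl⟩ := Prod.mk.inj hi
  exact Fin.forall_of_forall_add_one (Q := fun i => p i ∈ B) (fun i h => hB _ _ ⟨i, rfl⟩ h) ha i

namespace DecompositionRun

section Nodes

variable {V : Type*} {G : WDigraph V} (R : G.DecompositionRun)

lemma stage_mono : Monotone R.stage := by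
  intro i j hij a b h
  rw [stage, SimpleGraph.fromRel_adj] at h ⊢
  refine ⟨h.1, h.2.imp ?_ ?_⟩ <;> exact fun ⟨l, hl, hm⟩ => ⟨l, hl.trans hij, hm⟩

lemma reachable_of_mem_cycle {i : Fin G.edges.card} {u v : V}
    (h : (u, v) ∈ R.cycle (R.order i)) : (R.stage i).Reachable u v := by
  by_cases huv : u = v
  · rw [huv]
  · refine SimpleGraph.Adj.reachable ?_
    rw [stage, SimpleGraph.fromRel_adj]
    exact ⟨huv, Or.inl ⟨i, le_rfl, h⟩⟩

lemma supp_subset_supp {i j : Fin G.edges.card} (hij : i ≤ j) {c : (R.stage i).ConnectedComponent}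
    {d : (R.stage j).ConnectedComponent} {x : V} (hc : x ∈ c.supp) (hd : x ∈ d.supp) :
    c.supp ⊆ d.supp := by
  rw [SimpleGraph.ConnectedComponent.mem_supp_iff] at hc hd
  subst hc hd
  exact SimpleGraph.ConnectedComponent.connectedComponentMk_supp_subset_supp (R.stage_mono hij) _ rfl

lemma nodes_laminar {S S' : Set V} (hS : S ∈ R.nodes) (hS' : S' ∈ R.nodes)
    (h : (S ∩ S').Nonempty) : S ⊆ S' ∨ S' ⊆ S := by
  obtain ⟨i, c, rfl⟩ := hS
  obtain ⟨j, d, rfl⟩ := hS'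
  obtain ⟨x, hx, hx'⟩ := h
  rcases le_total i j with hij | hij
  · exact Or.inl (R.supp_subset_supp hij hx hx')
  · exact Or.inr (R.supp_subset_supp hij hx' hx)

lemma nodes_nonempty {S : Set V} (hS : S ∈ R.nodes) : S.Nonempty := by
  obtain ⟨i, c, rfl⟩ := hS
  exact c.nonempty_supp

lemma ncard_nodes_le [Fintype V] : R.nodes.ncard ≤ 2 * Fintype.card V :=
  Set.ncard_le_of_laminar (fun _ => R.nodes_nonempty) fun _ hA _ hB h => R.nodes_laminar hA hB h

/-- The cycle chosen for `e` puts both endpoints in one component, and laminarity makes a minimal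
such node the least one. -/
lemma exists_jumps [Fintype V] {e : V × V} (he : e ∈ G.edges) : ∃ S, R.Jumps S e := by
  have hm : (e.1, e.2) ∈ R.cycle (R.order (R.order.symm ⟨e, he⟩)) := by
    simpa using R.mem_cycle ⟨e, he⟩
  have hne : {S | S ∈ R.nodes ∧ e.1 ∈ S ∧ e.2 ∈ S}.Nonempty :=
    ⟨_, ⟨_, (R.stage _).connectedComponentMk e.1, rfl⟩, rfl,
      (SimpleGraph.ConnectedComponent.eq.mpr (R.reachable_of_mem_cycle hm)).symm⟩
  obtain ⟨S, ⟨hS, h1, h2⟩, hmin⟩ := (Set.toFinite _).exists_minimal hne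
  refine ⟨S, he, hS, h1, h2, fun S' hS' h1' h2' => ?_⟩
  rcases R.nodes_laminar hS hS' ⟨e.1, h1, h1'⟩ with h | h
  · exact h
  · exact hmin ⟨hS', h1', h2'⟩ h

lemma supp_subset_of_closed {i : Fin G.edges.card} (c : (R.stage i).ConnectedComponent)
    {B : Set V} (hB : ∀ u v, (∃ j ≤ i, (u, v) ∈ R.cycle (R.order j)) → u ∈ B → v ∈ B) {z : V}
    (hz : z ∈ c.supp) (hzB : z ∈ B) : c.supp ⊆ B := by
  intro x hx
  obtain ⟨p⟩ := c.reachable_of_mem_supp hz hx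
  clear hz hx
  induction p with
  | nil => exact hzB
  | cons h _ ih =>
    refine ih ?_
    rw [stage, SimpleGraph.fromRel_adj] at h
    rcases h.2 with h | ⟨j, hj, h⟩
    · exact hB _ _ h hzB
    · exact (R.isCycle _).mem_of_mem (fun u v huv hu => hB u v ⟨j, hj, huv⟩ hu) h hzB

/-- A node is a component of a stage such that all edges of the cycles in this stage have at least
some weight `w₀`, and all edges that jump between children of the node have weight at most
`m * w₀`. -/
lemma exists_stage {S : Set V} (hS : S ∈ R.nodes) :
    ∃ (i : Fin G.edges.card) (c : (R.stage i).ConnectedComponent) (w₀ : ℝ≥0), S = c.supp ∧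
      (∀ e, (∃ j ≤ i, e ∈ R.cycle (R.order j)) → w₀ ≤ G.weight e) ∧
      ∀ e, R.Jumps S e → G.weight e ≤ G.edges.card * w₀ := by
  obtain ⟨i, ⟨c, hc⟩, hmin⟩ := (Set.toFinite
    {i | ∃ c : (R.stage i).ConnectedComponent, S = c.supp}).exists_minimal hS
  refine ⟨i, c, G.minWeight (R.cycle (R.order i)), hc, ?_, ?_⟩
  · rintro e ⟨j, hj, he⟩
    exact (R.sorted hj).trans (G.minWeight_le he)
  · rintro e ⟨he, -, h1, h2, hlow⟩
    obtain ⟨j, hj⟩ := R.order.surjective ⟨e, he⟩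
    have hm : (e.1, e.2) ∈ R.cycle (R.order j) := by
      rw [hj]; exact R.mem_cycle ⟨e, he⟩
    -- Otherwise the endpoints of `e` are already joined at the earlier stage `j`; as `S` is lowest
    -- for `e`, that component equals `S`, against minimality of `i`.
    have hij : i ≤ j := by
      by_contra! hji
      let d := (R.stage j).connectedComponentMk e.1
      have hSd : S ⊆ d.supp := hlow d.supp ⟨j, d, rfl⟩ rfl
        (SimpleGraph.ConnectedComponent.eq.mpr (R.reachable_of_mem_cycle hm)).symm
      have hdS : d.supp ⊆ S := by
        rw [hc]
        exact R.supp_subset_supp hji.le (x := e.1) rfl (hc ▸ h1)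
      exact absurd (hmin ⟨d, hSd.antisymm hdS⟩ hji.le) (not_le.mpr hji)
    have h3 : G.weight e / G.edges.card ≤ G.minWeight (R.cycle (R.order j)) := by
      refine le_csInf ⟨_, _, hm, rfl⟩ ?_
      rintro _ ⟨e', he', rfl⟩
      have := R.le_weight _ e' he'
      rwa [hj] at this
    have hpos : (0 : ℝ≥0) < G.edges.card := by
      exact_mod_cast Finset.card_pos.mpr ⟨e, he⟩
    rw [div_le_iff₀' hpos] at h3
    exact h3.trans (by gcongr; exact R.sorted hij)

end Nodes

/-! ### Expected number of jumps in the chain -/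

section JumpCost

variable {V : Type*} [Fintype V] {G : WDigraph V} (R : G.DecompositionRun)

open Classical in
/-- The cost function that counts the edges between children of `S`. -/
noncomputable def jumpCost (S : Set V) (x y : V) : ℝ≥0 :=
  if R.Jumps S (x, y) then 1 else 0

lemma sum_weight_mul_jumpCost_le {S : Set V} {w : ℝ≥0} (hw : ∀ e, R.Jumps S e → G.weight e ≤ w) :
    ∑ x, ∑ y, G.weight (x, y) * R.jumpCost S x y ≤ G.edges.card * w := by
  classical
  rw [← Fintype.sum_prod_type' (f := fun x y => G.weight (x, y) * R.jumpCost S x y),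
    ← Finset.sum_subset (Finset.subset_univ G.edges)]
  · refine (Finset.sum_le_card_nsmul _ _ w fun e _ => ?_).trans (by simp)
    by_cases h : R.Jumps S e
    · simpa [jumpCost, h] using hw e h
    · simp [jumpCost, h]
  · intro e _ he
    rw [G.weight_eq_zero e he, zero_mul]

lemma hitCost_jumpCost_le (hG : G.Eulerian) {S : Set V} (hS : S ∈ R.nodes) {z : V} (hz : z ∈ S)
    (T : ℕ) (x : V) :
    G.hitCost (R.jumpCost S) z T x ≤ Fintype.card V * (G.edges.card : ℝ≥0) ^ 2 := by
  obtain ⟨i, c, w₀, hc, hheavy, hjump⟩ := R.exists_stage hS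
  -- Dividing by `w₀` needs `w₀ ≠ 0`; if it is 0, every jumping edge has probability 0 and the cost
  -- vanishes.
  rcases eq_or_ne w₀ 0 with rfl | hw₀
  · have : G.hitCost (R.jumpCost S) z T x = 0 := by
      induction T generalizing x with
      | zero => rfl
      | succ T ih =>
        by_cases hxz : x = z
        · subst hxz; exact G.hitCost_self _ _ _
        rw [G.hitCost_succ _ _ hxz]
        refine Finset.sum_eq_zero fun y _ => ?_
        rw [ih, add_zero]
        by_cases h : R.Jumps S (x, y)
        · have h0 : G.weight (x, y) = 0 := by simpa using hjump _ h
          simp [stepProb, h0]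
        · simp [jumpCost, h]
    rw [this]; exact zero_le
  refine G.hitCost_le_of_forall_mem _ (S := S) ?_ (fun T x hx => ?_) T x
  · intro x y hx
    exact if_neg fun h => hx h.2.2.1
  refine G.hitCost_le_of_closed _ (r := fun u v => ∃ j ≤ i, (u, v) ∈ R.cycle (R.order j)) ?_ ?_ T hx
  · intro u v huv T
    have h1 := (hG.weight_mul_hitCost_le (R.jumpCost S) u v T).trans
      (R.sum_weight_mul_jumpCost_le hjump)
    have h2 : w₀ * G.hitCost (R.jumpCost S) u T v ≤ w₀ * (G.edges.card : ℝ≥0) ^ 2 := by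
      refine (mul_le_mul_left (hheavy _ huv) _).trans (h1.trans (le_of_eq ?_))
      ring
    exact le_of_mul_le_mul_left h2 (pos_iff_ne_zero.mpr hw₀)
  · intro B hzB hB
    rw [hc]
    exact R.supp_subset_of_closed c hB (hc ▸ hz) hzB

lemma coverCost_jumpCost_le (hG : G.Eulerian) {S : Set V} (hS : S ∈ R.nodes) (T : ℕ) {x : V}
    {A : Set V} (hx : x ∈ A) :
    G.coverCost (R.jumpCost S) S T x A ≤
      (Fintype.card V : ℝ≥0) ^ 2 * (G.edges.card : ℝ≥0) ^ 2 := by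
  refine (G.coverCost_le _ (fun z hz T x => R.hitCost_jumpCost_le hG hS hz T x) T x A hx).trans ?_
  have : (S \ A).ncard ≤ Fintype.card V := by
    rw [← Nat.card_eq_fintype_card]; exact Set.ncard_le_card _
  rw [pow_two (Fintype.card V : ℝ≥0), mul_assoc]
  gcongr

end JumpCost

end DecompositionRun

end WDigraph

/-! ### Pathwise counting and the transcript -/

lemma encard_setOf_forall_encard_le {J : Set ℕ} {L : ℕ} :
    {k ∈ J | {i ∈ J | i ≤ k}.encard ≤ L}.encard ≤ L := by
  by_contra! h
  -- Among `L + 1` such elements, the largest has all of them at or below it.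
  obtain ⟨t, ht, htL⟩ := Set.exists_subset_encard_eq (Order.add_one_le_of_lt h)
  have htf : t.Finite := Set.finite_of_encard_eq_coe (k := L + 1) (by simpa using htL)
  have htne : t.Nonempty := by
    rw [← Set.encard_ne_zero, htL]; simp
  obtain ⟨k, hk, hmax⟩ := htf.exists_maximal htne
  have h1 : t ⊆ {i ∈ J | i ≤ k} := fun i hi =>
    ⟨(ht hi).1, (le_total i k).elim id fun hki => hmax hi hki⟩
  have h2 := (Set.encard_le_encard h1).trans (ht hk).2
  rw [htL] at h2
  exact absurd h2 (by exact_mod_cast Nat.not_succ_le_self L)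

lemma Function.update_image_Iic {V : Type*} (x : ℕ → V) (k : ℕ) (y : V) :
    Function.update x (k + 1) y '' Set.Iic (k + 1) = insert y (x '' Set.Iic k) := by
  have h : Set.Iic (k + 1) = insert (k + 1) (Set.Iic k) := by
    ext i; simp only [Set.mem_Iic, Set.mem_insert_iff]; omega
  rw [h, Set.image_insert_eq, Function.update_self]
  congr 1
  refine Set.image_congr fun i hi => Function.update_of_ne ?_ _ _
  rw [Set.mem_Iic] at hi
  omega

namespace WDigraph

namespace DecompositionRun

section Path

variable {V : Type*} {G : WDigraph V} (R : G.DecompositionRun)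

lemma encard_transcript_le [Fintype V] (L : ℕ) (x : ℕ → V) :
    (R.transcript L x).encard ≤ 2 * Fintype.card V * L := by
  have hfin : R.nodes.Finite := Set.toFinite _
  have h : R.transcript L x ⊆ ⋃ S ∈ hfin.toFinset,
      {k ∈ R.jumpSteps S x | {i ∈ R.jumpSteps S x | i ≤ k}.encard ≤ L} := by
    rintro k ⟨S, hS, hk⟩
    simp only [Set.mem_iUnion]
    exact ⟨S, hfin.mem_toFinset.mpr hS, hk⟩
  calc (R.transcript L x).encard
      ≤ ∑ S ∈ hfin.toFinset,
          {k ∈ R.jumpSteps S x | {i ∈ R.jumpSteps S x | i ≤ k}.encard ≤ L}.encard :=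
        (Set.encard_le_encard h).trans (Finset.set_encard_biUnion_le _ _)
    _ ≤ ∑ S ∈ hfin.toFinset, (L : ℕ∞) := by
        gcongr
        exact encard_setOf_forall_encard_le
    _ = (R.nodes.ncard : ℕ∞) * L := by
        rw [Finset.sum_const, nsmul_eq_mul, Set.ncard_eq_toFinset_card _ hfin]
    _ ≤ _ := by
        gcongr
        exact_mod_cast R.ncard_nodes_le

lemma le_jumpsBeforeCover {S : Set V} {x : ℕ → V} {L k : ℕ}
    (hL : (L : ℕ∞) ≤ {i ∈ R.jumpSteps S x | i < k}.encard) (hk : ¬ CoveredBy S x k) :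
    L ≤ R.jumpsBeforeCover S x := by
  refine hL.trans (Set.encard_le_encard ?_)
  rintro i ⟨hi, hik⟩
  refine ⟨hi, fun hc => hk fun v hv => ?_⟩
  obtain ⟨l, hl, h⟩ := hc v hv
  exact ⟨l, hl.trans hik.le, h⟩

/-- The lowest node `S` for the traversed edge contains the new vertex, so `S` is uncovered at time
`k`: fewer than `L` jumps of `S` came before, and step `k` makes at most `L`. -/
lemma mem_transcript_of_isFirstVisitStep [Fintype V] {x : ℕ → V} {L k : ℕ}
    (hcov : ∀ S ∈ R.nodes, ∀ k, (L : ℕ∞) ≤ {i ∈ R.jumpSteps S x | i < k}.encard →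
      CoveredBy S x k)
    (he : (x k, x (k + 1)) ∈ G.edges) (hk : IsFirstVisitStep x k) :
    k ∈ R.transcript L x := by
  obtain ⟨S, hS⟩ := R.exists_jumps he
  refine ⟨S, hS.2.1, hS, ?_⟩
  have hlt : {i ∈ R.jumpSteps S x | i < k}.encard < L := by
    by_contra! hL
    obtain ⟨i, hi, h⟩ := hcov S hS.2.1 k hL _ hS.2.2.2.1
    exact hk i hi h
  have hsub : {i ∈ R.jumpSteps S x | i ≤ k} ⊆ insert k {i ∈ R.jumpSteps S x | i < k} := by
    rintro i ⟨hi, hik⟩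
    rcases hik.eq_or_lt with h | h
    · exact Or.inl h
    · exact Or.inr ⟨hi, h⟩
  exact (Set.encard_le_encard hsub).trans ((Set.encard_insert_le _ _).trans
    (Order.add_one_le_of_lt hlt))

/-- The event that step `k` of the walk is a traversal of an edge between children of `S` before
`S` has been covered. -/
def jumpEvent {Ω : Type*} (X : ℕ → Ω → V) (S : Set V) (k : ℕ) :
    Set Ω :=
  {ω | k ∈ R.jumpSteps S (fun i => X i ω) ∧ ¬ CoveredBy S (fun i => X i ω) k}

lemma jumpsBeforeCover_eq_tsum {Ω : Type*} (X : ℕ → Ω → V) (S : Set V) (ω : Ω) :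
    (R.jumpsBeforeCover S (fun k => X k ω) : ℝ≥0∞) =
      ∑' k, (R.jumpEvent X S k).indicator 1 ω := by
  rw [jumpsBeforeCover, ← ENNReal.tsum_set_one, tsum_subtype _ fun _ => 1]
  rfl

end Path

end DecompositionRun

/-! ### From the chain to the random process -/

section RandomWalk

variable {V Ω : Type*} [Fintype V] [MeasurableSpace Ω] {P : Measure Ω} {G : WDigraph V}
  {X : ℕ → Ω → V} {v₀ : V}

lemma IsRandomWalk.measure_update (hX : G.IsRandomWalk P X v₀) (k : ℕ) (x : ℕ → V) (y : V) :
    P {ω | ∀ i ≤ k + 1, X i ω = Function.update x (k + 1) y i} =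
      P {ω | ∀ i ≤ k, X i ω = x i} * (G.stepProb (x k) y : ℝ≥0) := by
  classical
  rw [hX.step k (Function.update x (k + 1) y)]
  have h : ∀ i ≤ k, Function.update x (k + 1) y i = x i := fun i hi =>
    Function.update_of_ne (by omega) _ _
  rw [h k le_rfl, Function.update_self]
  congr 3
  ext ω
  exact forall₂_congr fun i hi => by rw [h i hi]

lemma measure_cylinder_inter_le (k : ℕ) (x : ℕ → V) (E : Set Ω) :
    P ({ω | ∀ i ≤ k, X i ω = x i} ∩ E) ≤
      ∑ y, P ({ω | ∀ i ≤ k + 1, X i ω = Function.update x (k + 1) y i} ∩ E) := by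
  refine (measure_mono ?_).trans (measure_iUnion_fintype_le P
    fun y => {ω | ∀ i ≤ k + 1, X i ω = Function.update x (k + 1) y i} ∩ E)
  rintro ω ⟨hω, hE⟩
  refine Set.mem_iUnion.mpr ⟨X (k + 1) ω, fun i hi => ?_, hE⟩
  rcases hi.lt_or_eq with h | rfl
  · rw [Function.update_of_ne (by omega), hω i (by omega)]
  · rw [Function.update_self]

lemma measurableSet_jumpEvent (hX : ∀ k v, MeasurableSet {ω | X k ω = v})
    (R : G.DecompositionRun) (S : Set V) (k : ℕ) : MeasurableSet (R.jumpEvent X S k) := by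
  have h1 : {ω | k ∈ R.jumpSteps S (fun i => X i ω)} =
      ⋃ (a : V) (b : V) (_ : R.Jumps S (a, b)), {ω | X k ω = a} ∩ {ω | X (k + 1) ω = b} := by
    ext ω
    simp only [Set.mem_iUnion]
    constructor
    · exact fun h => ⟨_, _, h, rfl, rfl⟩
    · rintro ⟨a, b, h, rfl, rfl⟩
      exact h
  have h2 : {ω | CoveredBy S (fun i => X i ω) k} = ⋂ v ∈ S, ⋃ i ≤ k, {ω | X i ω = v} := by
    ext ω
    simp [CoveredBy]
  have h3 : R.jumpEvent X S k = {ω | k ∈ R.jumpSteps S (fun i => X i ω)} ∩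
      {ω | CoveredBy S (fun i => X i ω) k}ᶜ := rfl
  rw [h3, h1, h2]
  refine MeasurableSet.inter ?_ (MeasurableSet.compl ?_)
  · exact .iUnion fun a => .iUnion fun b => .iUnion fun _ => (hX _ _).inter (hX _ _)
  · exact .biInter (Set.to_countable S) fun v _ =>
      .biUnion (Set.to_countable (Set.Iic k)) fun i _ => hX _ _

/-- The expected number of jumps before covering, conditional on the history of the walk, is at
most the expected cost in the Markov chain. -/
lemma IsRandomWalk.sum_measure_jumpEvent_le (hX : G.IsRandomWalk P X v₀) (R : G.DecompositionRun)
    (S : Set V) (T k : ℕ) (x : ℕ → V) :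
    ∑ j ∈ Finset.range T, P ({ω | ∀ i ≤ k, X i ω = x i} ∩ R.jumpEvent X S (k + j)) ≤
      P {ω | ∀ i ≤ k, X i ω = x i} *
        (G.coverCost (R.jumpCost S) S T (x k) (x '' Set.Iic k) : ℝ≥0) := by
  classical
  induction T generalizing k x with
  | zero => simp
  | succ T ih =>
    -- If the history already covers `S`, no jump event meets its cylinder; otherwise condition on
    -- the next vertex `y`.
    by_cases hS : S ⊆ x '' Set.Iic k
    · rw [Finset.sum_eq_zero fun j _ => ?_]
      · exact zero_le
      refine measure_mono_null ?_ (measure_empty (μ := P))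
      rintro ω ⟨hω, -, hc⟩
      refine hc fun v hv => ?_
      obtain ⟨i, hi, rfl⟩ := hS hv
      exact ⟨i, le_trans hi (Nat.le_add_right _ _), hω i hi⟩
    set C : V → Set Ω := fun y => {ω | ∀ i ≤ k + 1, X i ω = Function.update x (k + 1) y i}
    have h0 : ∀ y, P (C y ∩ R.jumpEvent X S k) ≤ P (C y) * (R.jumpCost S (x k) y : ℝ≥0) := by
      intro y
      by_cases hJ : R.Jumps S (x k, y)
      · simpa [DecompositionRun.jumpCost, hJ] using
          measure_mono (Set.inter_subset_left (s := C y))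
      · refine (measure_mono_null ?_ (measure_empty (μ := P))).le.trans zero_le
        rintro ω ⟨hω, hj, -⟩
        have h1 := hω k k.le_succ
        have h2 := hω (k + 1) le_rfl
        rw [Function.update_of_ne (by omega)] at h1
        rw [Function.update_self] at h2
        refine hJ ?_
        rw [← h1, ← h2]
        exact hj
    calc ∑ j ∈ Finset.range (T + 1), P ({ω | ∀ i ≤ k, X i ω = x i} ∩ R.jumpEvent X S (k + j))
        ≤ ∑ j ∈ Finset.range (T + 1), ∑ y, P (C y ∩ R.jumpEvent X S (k + j)) :=
          Finset.sum_le_sum fun j _ => measure_cylinder_inter_le k x _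
      _ = ∑ y, (P (C y ∩ R.jumpEvent X S k) +
            ∑ j ∈ Finset.range T, P (C y ∩ R.jumpEvent X S (k + 1 + j))) := by
          rw [Finset.sum_comm]
          refine Finset.sum_congr rfl fun y _ => ?_
          rw [Finset.sum_range_succ', add_comm]
          simp only [add_zero, add_assoc, add_comm 1]
      _ ≤ ∑ y, (P (C y) * (R.jumpCost S (x k) y : ℝ≥0) +
            P (C y) * (G.coverCost (R.jumpCost S) S T y (insert y (x '' Set.Iic k)) : ℝ≥0)) := by
          refine Finset.sum_le_sum fun y _ => add_le_add (h0 y) ?_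
          have := ih (k + 1) (Function.update x (k + 1) y)
          rwa [Function.update_image_Iic, Function.update_self] at this
      _ = _ := by
          rw [coverCost_succ _ _ hS, ENNReal.ofNNReal_finsetSum, Finset.mul_sum]
          refine Finset.sum_congr rfl fun y _ => ?_
          rw [← mul_add, hX.measure_update, mul_assoc, ENNReal.coe_mul, ENNReal.coe_add]

lemma measurable_jumpsBeforeCover (hX : ∀ k v, MeasurableSet {ω | X k ω = v})
    (R : G.DecompositionRun) (S : Set V) :
    Measurable fun ω => (R.jumpsBeforeCover S (fun k => X k ω) : ℝ≥0∞) := by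
  simp only [DecompositionRun.jumpsBeforeCover_eq_tsum]
  exact Measurable.tsum fun k =>
    measurable_one.indicator (measurableSet_jumpEvent hX R S k)

theorem IsRandomWalk.lintegral_jumpsBeforeCover_le [IsProbabilityMeasure P] (hG : G.Eulerian)
    (R : G.DecompositionRun) (hX : G.IsRandomWalk P X v₀) {S : Set V} (hS : S ∈ R.nodes) :
    ∫⁻ ω, (R.jumpsBeforeCover S (fun k => X k ω) : ℝ≥0∞) ∂P ≤
      (Fintype.card V : ℝ≥0∞) ^ 2 * (G.edges.card : ℝ≥0∞) ^ 2 := by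
  have hE := measurableSet_jumpEvent hX.measurableSet_eq R S
  simp only [DecompositionRun.jumpsBeforeCover_eq_tsum]
  rw [lintegral_tsum fun k => (measurable_one.indicator (hE k)).aemeasurable]
  simp only [lintegral_indicator_one (hE _)]
  refine ENNReal.tsum_le_of_sum_range_le fun T => ?_
  have h := hX.sum_measure_jumpEvent_le R S T 0 (fun _ => v₀)
  have h0 : ∀ E : Set Ω, P ({ω | ∀ i ≤ 0, X i ω = v₀} ∩ E) = P E := fun E => by
    refine measure_congr ?_
    filter_upwards [hX.start] with ω hω
    refine propext ⟨fun h => h.2, fun h => ⟨fun i hi => ?_, h⟩⟩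
    rw [Nat.le_zero.mp hi]
    exact hω
  simp only [h0, zero_add] at h
  refine h.trans ((mul_le_of_le_one_left' prob_le_one).trans ?_)
  have hv : v₀ ∈ (fun _ : ℕ => v₀) '' Set.Iic 0 := ⟨0, Set.mem_Iic.mpr le_rfl, rfl⟩
  exact_mod_cast R.coverCost_jumpCost_le hG hS T hv

/-- For each `k` there are finitely many histories up to time `k + 1`, and those ending in a
non-edge have probability 0. -/
lemma IsRandomWalk.ae_mem_edges (hX : G.IsRandomWalk P X v₀) :
    ∀ᵐ ω ∂P, ∀ k, (X k ω, X (k + 1) ω) ∈ G.edges := by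
  classical
  refine ae_all_iff.mpr fun k => ?_
  let Y : Ω → Fin (k + 2) → V := fun ω i => X i ω
  have hsub : {ω | ¬ (X k ω, X (k + 1) ω) ∈ G.edges} ⊆
      ⋃ y : {y : Fin (k + 2) → V // (y (Fin.last k).castSucc, y (Fin.last (k + 1))) ∉ G.edges},
        {ω | ∀ i ≤ k + 1, X i ω = y.1 (Fin.ofNat (k + 2) i)} := by
    intro ω hω
    refine Set.mem_iUnion.mpr ⟨⟨Y ω, hω⟩, fun i hi => ?_⟩
    simp only [Y, Fin.ofNat]
    rw [Nat.mod_eq_of_lt (by omega)]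
  refine measure_mono_null hsub (measure_iUnion_null fun y => ?_)
  have h := hX.step k fun i => y.1 (Fin.ofNat (k + 2) i)
  have e1 : Fin.ofNat (k + 2) k = (Fin.last k).castSucc := by
    ext; simp [Fin.ofNat]
  have e2 : Fin.ofNat (k + 2) (k + 1) = Fin.last (k + 1) := by
    ext; simp [Fin.ofNat]
  rw [h, e1, e2, G.weight_eq_zero _ y.2]
  simp

lemma IsRandomWalk.measure_le_jumpsBeforeCover [IsProbabilityMeasure P] (hG : G.Eulerian)
    (R : G.DecompositionRun) (hX : G.IsRandomWalk P X v₀) {S : Set V} (hS : S ∈ R.nodes) {L : ℕ}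
    (hL : L ≠ 0) :
    P {ω | (L : ℕ∞) ≤ R.jumpsBeforeCover S (fun k => X k ω)} ≤
      (Fintype.card V : ℝ≥0∞) ^ 2 * (G.edges.card : ℝ≥0∞) ^ 2 / L := by
  have h := meas_ge_le_lintegral_div
    (measurable_jumpsBeforeCover hX.measurableSet_eq R S).aemeasurable (μ := P) (ε := (L : ℝ≥0∞))
    (by exact_mod_cast hL) (ENNReal.natCast_ne_top L)
  refine le_trans (measure_mono fun ω hω => ?_)
    (h.trans (by gcongr; exact hX.lintegral_jumpsBeforeCover_le hG R hS))
  have := ENat.toENNReal_le.mpr hω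
  simpa using this

/-- Failure is, up to a null set, contained in the union over nodes of "at least `L` jumps before
cover", of total probability at most `2n * n² * m² / L`. The `+ 1` in the bound on `L` keeps `L`
nonzero. -/
theorem IsRandomWalk.one_sub_le_measure [IsProbabilityMeasure P] (hG : G.Eulerian)
    (R : G.DecompositionRun) (hX : G.IsRandomWalk P X v₀) (c : ℕ) {L : ℕ}
    (hL : 2 * Fintype.card V ^ 3 * G.edges.card ^ 2 * (Fintype.card V + G.edges.card) ^ c + 1 ≤ L) :
    1 - 1 / ((Fintype.card V + G.edges.card : ℕ) : ℝ≥0∞) ^ c ≤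
      P {ω |
        (∀ S ∈ R.nodes, ∀ k,
          (L : ℕ∞) ≤ {i ∈ R.jumpSteps S (fun k => X k ω) | i < k}.encard →
            CoveredBy S (fun k => X k ω) k) ∧
        ∀ k, IsFirstVisitStep (fun k => X k ω) k → k ∈ R.transcript L (fun k => X k ω)} := by
  have hfin : R.nodes.Finite := Set.toFinite _
  set A := {ω |
        (∀ S ∈ R.nodes, ∀ k,
          (L : ℕ∞) ≤ {i ∈ R.jumpSteps S (fun k => X k ω) | i < k}.encard →
            CoveredBy S (fun k => X k ω) k) ∧
        ∀ k, IsFirstVisitStep (fun k => X k ω) k → k ∈ R.transcript L (fun k => X k ω)}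
  set B := ⋃ S ∈ hfin.toFinset, {ω | (L : ℕ∞) ≤ R.jumpsBeforeCover S (fun k => X k ω)}
  have hN : (((Fintype.card V + G.edges.card : ℕ) : ℝ≥0∞) ^ c) ≠ 0 := by
    have : Nonempty V := ⟨v₀⟩
    have := Fintype.card_pos (α := V)
    exact pow_ne_zero _ (by exact_mod_cast (by omega))
  have hL0 : (L : ℝ≥0∞) ≠ 0 := by exact_mod_cast (by omega : L ≠ 0)
  have hcover : ∀ᵐ ω ∂P, ω ∈ A ∪ B := by
    filter_upwards [hX.ae_mem_edges] with ω hω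
    by_cases hB : ω ∈ B
    · exact Or.inr hB
    have hcov : ∀ S ∈ R.nodes, ∀ k,
        (L : ℕ∞) ≤ {i ∈ R.jumpSteps S (fun k => X k ω) | i < k}.encard →
          CoveredBy S (fun k => X k ω) k := by
      intro S hS k hk
      by_contra hc
      refine hB ?_
      simp only [B, Set.mem_iUnion]
      exact ⟨S, hfin.mem_toFinset.mpr hS, R.le_jumpsBeforeCover hk hc⟩
    exact Or.inl ⟨hcov, fun k hk => R.mem_transcript_of_isFirstVisitStep hcov (hω k) hk⟩
  have hB : P B ≤ 1 / ((Fintype.card V + G.edges.card : ℕ) : ℝ≥0∞) ^ c := by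
    calc P B ≤ ∑ S ∈ hfin.toFinset, P {ω | (L : ℕ∞) ≤ R.jumpsBeforeCover S (fun k => X k ω)} :=
          measure_biUnion_finset_le _ _
      _ ≤ ∑ S ∈ hfin.toFinset,
            (Fintype.card V : ℝ≥0∞) ^ 2 * (G.edges.card : ℝ≥0∞) ^ 2 / L :=
          Finset.sum_le_sum fun S hS =>
            hX.measure_le_jumpsBeforeCover hG R (hfin.mem_toFinset.mp hS) (by omega)
      _ = (R.nodes.ncard : ℝ≥0∞) *
            ((Fintype.card V : ℝ≥0∞) ^ 2 * (G.edges.card : ℝ≥0∞) ^ 2 / L) := by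
          rw [Finset.sum_const, nsmul_eq_mul, Set.ncard_eq_toFinset_card _ hfin]
      _ ≤ ((2 * Fintype.card V : ℕ) : ℝ≥0∞) *
            ((Fintype.card V : ℝ≥0∞) ^ 2 * (G.edges.card : ℝ≥0∞) ^ 2 / L) := by
          gcongr
          exact R.ncard_nodes_le
      _ ≤ _ := by
          rw [← mul_div_assoc, ENNReal.div_le_iff hL0 (ENNReal.natCast_ne_top L),
            mul_comm (1 / _), mul_one_div, ENNReal.le_div_iff_mul_le (Or.inl hN)
              (Or.inl (by finiteness))]
          have : 2 * Fintype.card V * (Fintype.card V ^ 2 * G.edges.card ^ 2) *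
              (Fintype.card V + G.edges.card) ^ c ≤ L := by
            refine le_trans (le_of_eq ?_) ((Nat.le_succ _).trans hL)
            ring
          exact_mod_cast this
  rw [tsub_le_iff_right]
  -- Subadditivity of the outer measure suffices, so `A` need not be shown measurable.
  calc 1 = P Set.univ := measure_univ.symm
    _ ≤ P (A ∪ B) := measure_mono_ae (hcover.mono fun _ h _ => h)
    _ ≤ P A + P B := measure_union_le _ _
    _ ≤ _ := by gcongr

end RandomWalk

end WDigraph

theorem mainTheorem4 :
    (∀ (V Ω : Type*) [Fintype V] [MeasurableSpace Ω] (P : Measure Ω) [IsProbabilityMeasure P]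
      (G : WDigraph V) (_ : G.Eulerian) (R : G.DecompositionRun)
      (v₀ : V) (X : ℕ → Ω → V) (_ : G.IsRandomWalk P X v₀),
      ∀ S ∈ R.nodes,
        ∫⁻ ω, (R.jumpsBeforeCover S (fun k => X k ω) : ℝ≥0∞) ∂P
          ≤ (Fintype.card V : ℝ≥0∞) ^ 2 * (G.edges.card : ℝ≥0∞) ^ 2) ∧
    (∀ c : ℕ, ∃ p : MvPolynomial (Fin 2) ℕ,
      ∀ (V Ω : Type*) [Fintype V] [MeasurableSpace Ω] (P : Measure Ω) [IsProbabilityMeasure P]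
        (G : WDigraph V) (_ : G.Eulerian) (R : G.DecompositionRun)
        (v₀ : V) (X : ℕ → Ω → V) (_ : G.IsRandomWalk P X v₀)
        (L : ℕ), MvPolynomial.eval ![Fintype.card V, G.edges.card] p ≤ L →
        (∀ ω, (R.transcript L (fun k => X k ω)).encard ≤ 2 * Fintype.card V * L) ∧
        1 - 1 / ((Fintype.card V + G.edges.card : ℕ) : ℝ≥0∞) ^ c ≤
          P {ω |
            (∀ S ∈ R.nodes, ∀ k,
              (L : ℕ∞) ≤ {i ∈ R.jumpSteps S (fun k => X k ω) | i < k}.encard →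
                CoveredBy S (fun k => X k ω) k) ∧
            ∀ k, IsFirstVisitStep (fun k => X k ω) k → k ∈ R.transcript L (fun k => X k ω)}) := by

  refine ⟨fun V Ω _ _ P _ G hG R v₀ X hX S hS => hX.lintegral_jumpsBeforeCover_le hG R hS,
    fun c => ⟨2 * .X 0 ^ 3 * .X 1 ^ 2 * (.X 0 + .X 1) ^ c + 1,
      fun V Ω _ _ P _ G hG R v₀ X hX L hL =>
        ⟨fun ω => R.encard_transcript_le L _, hX.one_sub_le_measure hG R c ?_⟩⟩⟩
  simpa using hL
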